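/- **Theorem.** Let $m\ge 2$ agents form a network and let $W\in\mathbb R^{m\times m}$ be a symmetric matrix with $W_{ij}\ne 0$ if and only if $i=j$ or $i,j$ are connected by an edge, $0\preceq W\preceq I$, $W\mathbf 1=\mathbf 1$ and $\mathrm{null}(I-W)=\mathrm{span}(\mathbf 1)$; let $\lambda_2=\lambda_2(W)$ be its second largest eigenvalue. Let $L>0$, let each $f_i:\mathbb R^d\to\mathbb R$ $(1\le i\le m)$ be differentiable, convex and $L$-smooth, i.e. $0\le f_i(y)-f_i(x)-\langle\nabla f_i(x),y-x\rangle\le\frac L2\|x-y\|^2$ for all $x,y$, let $g:\mathbb R^d\to\mathbb R$ be convex, put $F(x)=\frac1m\sum_{i=1}^m f_i(x)+g(x)$, and let $x^*$ be a minimizer of $F$. For $\mathbf x\in\mathbb R^{m\times d}$ with rows $\mathbf x^{(i)}$ let $\|\mathbf x\|$ be the Frobenius norm, $\overline x=\frac1m\sum_i\mathbf x^{(i)}$, $\Pi=I-\frac1m\mathbf 1\mathbf 1^\top$, $\nabla f(\mathbf x)$ the matrix with rows $\nabla f_i(\mathbf x^{(i)})$, and $\mathrm{prox}_{\gamma g}(\mathbf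 x)$ the matrix with rows $\mathrm{argmin}_w\{\gamma g(w)+\frac12\|w-\mathbf x^{(i)}\|^2\}$. Let $\mathrm{FastMix}(\mathbf x,K)=\mathbf x^K$, where $\mathbf x^0=\mathbf x^1=\mathbf x$, $\mathbf x^{k+1}=(1+\eta)W\mathbf x^k-\eta\,\mathbf x^{k-1}$ and $\eta=1/(1+\sqrt{1-\lambda_2^2})$. Let $c_f=200$, $\gamma_t=\frac{t+4}{2Lc_f}$, $\tau_t=\frac1{Lc_f\gamma_t}=\frac2{t+4}$, and let $K$ be an integer with $K\ge 15/\sqrt{1-\lambda_2}$ (for instance $K=\lceil 15/\sqrt{1-\lambda_2}\,\rceil$). Starting from $x_1\in\mathbb R^d$, set $\mathbf x_1=\mathbf y_1=\mathbf z_1=\mathbf 1x_1$, $\mathbf s_1=\nabla f(\mathbf x_1)$ and, for $t\ge1$, $$\mathbf x_{t+1}=\tau_t\mathbf z_t+(1-\tau_t)\mathbf y_t,\qquad \mathbf s_{t+1}=\mathrm{FastMix}(\mathbf s_t+\nabla f(\mathbf x_{t+1})-\nabla f(\mathbf x_t),K),$$ $$\mathbf z_{t+1}=\mathrm{FastMix}(\mathrm{prox}_{\gamma_t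 g}(\mathbf z_t-\gamma_t\mathbf s_{t+1}),K),\qquad \mathbf y_{t+1}=\mathrm{FastMix}(\tau_t\mathbf z_{t+1}+(1-\tau_t)\mathbf y_t,K).$$ Then for every $T\ge 2$ $$F(\overline y_T)-F(x^*)\le\frac{15}{(T+3)^2}\big(F(\overline y_1)-F(x^*)\big)+\frac{2Lc_f}{m(T+3)^2}\|\mathbf z_1-\mathbf 1x^*\|^2+\frac{50L}{m(T+3)^2}\Big(\|\Pi\mathbf x_1\|^2+\frac{9\tau_1^2}{32}\|\Pi\mathbf z_1\|^2+\frac{5}{14L^2c_f^2}\|\Pi\mathbf s_1\|^2\Big).$$ -/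

import Mathlib

noncomputable section

namespace ODAPG

/-- The space of decision vectors, with its Euclidean norm. -/
abbrev Vec (d : ℕ) := EuclideanSpace ℝ (Fin d)

/-- An `m × d` real matrix, given by its `m` rows (one local copy for each agent). The norm used on
it is `frobSq` below, never the default sup norm of a function space. -/
abbrev Rows (m d : ℕ) := Fin m → Vec d

variable {m d : ℕ}

/-- The squared Frobenius norm `‖x‖²`. -/
def frobSq (x : Rows m d) : ℝ := ∑ i, ‖x i‖ ^ 2

/-- The matrix product `A x` of an `m × m` matrix with an `m × d` matrix. -/
def mulRows (A : Matrix (Fin m) (Fin m) ℝ) (x : Rows m d) : Rows m d :=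
  fun i => ∑ j, A i j • x j

/-- The average `(1/m) 1ᵀ x` of the rows. -/
def avg (x : Rows m d) : Vec d := (1 / (m : ℝ)) • ∑ i, x i

/-- The matrix `1 v` all of whose rows equal `v`. -/
def constRows (m : ℕ) (v : Vec d) : Rows m d := fun _ => v

/-- The projection matrix `Π = I - 1 1ᵀ / m`. -/
def centering (m : ℕ) : Matrix (Fin m) (Fin m) ℝ :=
  1 - (1 / (m : ℝ)) • Matrix.of fun _ _ => (1 : ℝ)

/-- `f` is differentiable, convex and `L`-smooth. -/
structure IsConvexSmooth (L : ℝ) (f : Vec d → ℝ) : Prop where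
  differentiable : Differentiable ℝ f
  lower : ∀ x y, f x + inner ℝ (gradient f x) (y - x) ≤ f y
  upper : ∀ x y, f y ≤ f x + inner ℝ (gradient f x) (y - x) + L / 2 * ‖x - y‖ ^ 2

/-- The composite objective `F(x) = (1/m) ∑ᵢ fᵢ(x) + g(x)`. -/
def objective (f : Fin m → Vec d → ℝ) (g : Vec d → ℝ) (x : Vec d) : ℝ :=
  (1 / (m : ℝ)) * ∑ i, f i x + g x

/-- `W` is a weight matrix for the network `G`: `0 ⪯ W ⪯ I` (in particular `W` is symmetric),
`W i j ≠ 0` exactly when `i = j` or `i`, `j` are connected by an edge, `W 1 = 1` and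
`null (I - W) = span (1)`. -/
structure IsWeightMatrix (G : SimpleGraph (Fin m)) (W : Matrix (Fin m) (Fin m) ℝ) : Prop where
  posSemidef : W.PosSemidef
  le_one : (1 - W).PosSemidef
  support : ∀ i j, W i j ≠ 0 ↔ (G.Adj i j ∨ i = j)
  mulVec_one : W.mulVec 1 = 1
  null_eq : LinearMap.ker (Matrix.mulVecLin (1 - W)) = Submodule.span ℝ {(1 : Fin m → ℝ)}

/-- The second largest eigenvalue (with multiplicity) of a symmetric matrix:
`Matrix.IsHermitian.eigenvalues₀` lists the eigenvalues in decreasing order. -/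
def lambda2 (hm : 2 ≤ m) {W : Matrix (Fin m) (Fin m) ℝ} (hW : W.IsHermitian) : ℝ :=
  hW.eigenvalues₀ ⟨1, by rw [Fintype.card_fin]; omega⟩

/-- The parameter `η_w = 1 / (1 + √(1 - λ₂²))` of `FastMix`. -/
def mixParam (lam : ℝ) : ℝ := 1 / (1 + Real.sqrt (1 - lam ^ 2))

/-- `FastMix`: `x⁰ = x¹ = x`, `xᵏ⁺¹ = (1 + η) W xᵏ - η xᵏ⁻¹`; the output after `K` rounds
is `x^K`. -/
def fastMix (W : Matrix (Fin m) (Fin m) ℝ) (η : ℝ) (x : Rows m d) : ℕ → Rows m d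
  | 0 => x
  | 1 => x
  | k + 2 => (1 + η) • mulRows W (fastMix W η x (k + 1)) - η • fastMix W η x k

/-- `prox_{γ g}(x)`, the minimizer of `w ↦ γ g(w) + ‖w - x‖² / 2`; it exists and is unique for
`γ > 0` and `g` convex. -/
def prox (γ : ℝ) (g : Vec d → ℝ) (x : Vec d) : Vec d :=
  Classical.epsilon fun w =>
    ∀ u, γ * g w + 1 / 2 * ‖w - x‖ ^ 2 ≤ γ * g u + 1 / 2 * ‖u - x‖ ^ 2

/-- The aggregated proximal operator, acting row by row. -/
def proxRows (γ : ℝ) (g : Vec d → ℝ) (x : Rows m d) : Rows m d := fun i => prox γ g (x i)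

/-- The aggregated gradient, whose `i`-th row is `∇fᵢ(xⁱ)`. -/
def gradRows (f : Fin m → Vec d → ℝ) (x : Rows m d) : Rows m d := fun i => gradient (f i) (x i)

/-- The variables of the algorithm. -/
structure State (m d : ℕ) where
  x : Rows m d
  y : Rows m d
  z : Rows m d
  s : Rows m d

/-- The initialization `z₁ = y₁ = x₁ = 1 x₁`, `s₁ⁱ = ∇fᵢ(x₁)`. -/
def initState (f : Fin m → Vec d → ℝ) (x₁ : Vec d) : State m d where
  x := constRows m x₁
  y := constRows m x₁
  z := constRows m x₁
  s := gradRows f (constRows m x₁)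

/-- One iteration with step sizes `γ`, `τ`, and `mix` as the averaging operator. -/
def step (mix : Rows m d → Rows m d) (f : Fin m → Vec d → ℝ) (g : Vec d → ℝ) (γ τ : ℝ)
    (S : State m d) : State m d :=
  let x' := τ • S.z + (1 - τ) • S.y
  let s' := mix (S.s + gradRows f x' - gradRows f S.x)
  let z' := mix (proxRows γ g (S.z - γ • s'))
  let y' := mix (τ • z' + (1 - τ) • S.y)
  { x := x', y := y', z := z', s := s' }

/-- The state `(x_t, y_t, z_t, s_t)` at time `t ≥ 1`; the initial state is that at time `1`
(the value at `t = 0` is a placeholder). -/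
def run (mix : Rows m d → Rows m d) (f : Fin m → Vec d → ℝ) (g : Vec d → ℝ) (γ τ : ℕ → ℝ)
    (x₁ : Vec d) : ℕ → State m d
  | 0 => initState f x₁
  | 1 => initState f x₁
  | t + 2 => step mix f g (γ (t + 1)) (τ (t + 1)) (run mix f g γ τ x₁ (t + 1))

end ODAPG

end

/-!
`FastMix` acts on an eigenvector of `W` through a scalar two-term recursion, which has a quadratic
first integral. For eigenvalues up to `λ₂` this bounds the squared factor after `K` rounds by
`4 ηᴷ`, so `FastMix` keeps averages and contracts squared deviations from consensus by `4 / 2¹⁵`.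

The tracked gradients keep the exact average of the local gradients, so the averaged iterates
perform an inexact accelerated proximal gradient step, and the usual Lyapunov function
`m (F(ȳ) - F(x*)) / τ² + (L c / 2) ‖z - 1 x*‖²` decreases up to a combination of consensus errors.
After scaling by the step sizes these errors obey a linear recursion with fixed small constants. A
positive combination of them therefore serves as a potential that pays for the errors of all later
steps, and adding it to the Lyapunov function makes the sum telescope.
-/

namespace ODAPG

/-- The factor `pₖ` by which `k` rounds of `FastMix` scale an eigenvector of the weight matrix with
eigenvalue `μ`. -/
def mixFactor {R : Type*} [CommRing R] (η μ : R) : ℕ → R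
  | 0 => 1
  | 1 => 1
  | k + 2 => (1 + η) * μ * mixFactor η μ (k + 1) - η * mixFactor η μ k

lemma mixFactor_energy {R : Type*} [CommRing R] (η μ : R) (k : ℕ) :
    mixFactor η μ (k + 1) ^ 2 + η * mixFactor η μ k ^ 2
      - (1 + η) * μ * mixFactor η μ (k + 1) * mixFactor η μ k = η ^ k * ((1 + η) * (1 - μ)) := by
  induction k with
  | zero => simp only [mixFactor]; ring
  | succ k ih =>
    rw [mixFactor]
    linear_combination η * ih

lemma mixFactor_one {R : Type*} [CommRing R] (η : R) : ∀ k, mixFactor η 1 k = 1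
  | 0 => rfl
  | 1 => rfl
  | k + 2 => by
    rw [mixFactor, mixFactor_one η k, mixFactor_one η (k + 1)]
    ring

section MixFactor

variable {η lam μ : ℝ}

lemma mixFactor_discrim_mul_sq_le (η μ : ℝ) (k : ℕ) :
    (4 * η - (1 + η) ^ 2 * μ ^ 2) * mixFactor η μ (k + 1) ^ 2
      ≤ 4 * η ^ (k + 1) * ((1 + η) * (1 - μ)) := by
  linear_combination 4 * η * mixFactor_energy η μ k
    + sq_nonneg ((1 + η) * μ * mixFactor η μ (k + 1) - 2 * η * mixFactor η μ k)

lemma le_mixFactor_discrim (hη : η ≤ 1) (hlam₀ : 0 ≤ lam) (hlam₁ : lam ≤ 1)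
    (hrel : η ^ 2 * lam ^ 2 = 2 * η - 1) (hμ₀ : 0 ≤ μ) (hμ : μ ≤ lam) :
    2 * η * ((1 + η) * (1 - μ)) ≤ 4 * η - (1 + η) ^ 2 * μ ^ 2 := by
  have hη₀ : 0 < η := by nlinarith only [hrel, sq_nonneg (η * lam)]
  have hηlam : 2 * η ≤ 1 + lam := by
    have : η ^ 2 * lam ^ 2 ≤ lam := by
      rw [← mul_pow]
      nlinarith only [mul_le_of_le_one_left hlam₀ hη, mul_nonneg hη₀.le hlam₀, hlam₁]
    linarith
  have at_lam : 2 * η * ((1 + η) * (1 - lam)) ≤ 4 * η - (1 + η) ^ 2 * lam ^ 2 := by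
    calc 2 * η * ((1 + η) * (1 - lam)) ≤ (1 - lam) * (2 * η * (1 + 2 * η)) := by
          nlinarith only [mul_nonneg hη₀.le (mul_nonneg hη₀.le (sub_nonneg.2 hlam₁))]
      _ ≤ (1 - lam) * ((1 + lam) * (1 + 2 * η)) := by
          have := sub_nonneg.2 hlam₁
          gcongr
      _ = 4 * η - (1 + η) ^ 2 * lam ^ 2 := by linear_combination hrel
  rcases le_total ((1 + η) * μ) (2 * η) with h | h
  · nlinarith only [mul_nonneg (mul_nonneg (by positivity : 0 ≤ 1 + η) hμ₀) (sub_nonneg.2 h),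
      mul_nonneg hη₀.le (sub_nonneg.2 hη)]
  · have hmono : (1 + η) * μ * ((1 + η) * μ - 2 * η) ≤ (1 + η) * lam * ((1 + η) * lam - 2 * η) := by
      have := sub_nonneg.2 h
      gcongr
    linarith

lemma mixFactor_sq_le (hη : η ≤ 1) (hlam₀ : 0 ≤ lam) (hlam₁ : lam < 1)
    (hrel : η ^ 2 * lam ^ 2 = 2 * η - 1) (hμ₀ : 0 ≤ μ) (hμ : μ ≤ lam) (K : ℕ) :
    mixFactor η μ K ^ 2 ≤ 4 * η ^ K := by
  have hη₀ : 1 / 2 ≤ η := by linarith only [hrel, sq_nonneg (η * lam), mul_pow η lam 2]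
  obtain _ | k := K
  · norm_num [mixFactor]
  have hμ₁ : 0 < 1 - μ := by linarith
  have hD := le_mixFactor_discrim hη hlam₀ hlam₁.le hrel hμ₀ hμ
  have hD₀ : 0 < 4 * η - (1 + η) ^ 2 * μ ^ 2 := lt_of_lt_of_le (by positivity) hD
  refine le_of_mul_le_mul_left ?_ hD₀
  calc (4 * η - (1 + η) ^ 2 * μ ^ 2) * mixFactor η μ (k + 1) ^ 2
      ≤ 2 * η ^ k * (2 * η * ((1 + η) * (1 - μ))) :=
        (mixFactor_discrim_mul_sq_le η μ k).trans_eq (by ring)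
    _ ≤ 2 * η ^ k * (4 * η - (1 + η) ^ 2 * μ ^ 2) := by gcongr
    _ ≤ 4 * η ^ (k + 1) * (4 * η - (1 + η) ^ 2 * μ ^ 2) := by
        gcongr ?_ * _
        rw [pow_succ]
        nlinarith only [hη₀, pow_pos (by linarith : 0 < η) k]
    _ = (4 * η - (1 + η) ^ 2 * μ ^ 2) * (4 * η ^ (k + 1)) := mul_comm _ _

end MixFactor

lemma mixParam_le_one (lam : ℝ) : mixParam lam ≤ 1 :=
  div_le_one_of_le₀ (by linarith [Real.sqrt_nonneg (1 - lam ^ 2)]) (by positivity)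

lemma mixParam_sq_mul_sq {lam : ℝ} (hlam : lam ^ 2 ≤ 1) :
    mixParam lam ^ 2 * lam ^ 2 = 2 * mixParam lam - 1 := by
  have hs := Real.sq_sqrt (sub_nonneg.2 hlam)
  have : 0 < 1 + √(1 - lam ^ 2) := by positivity
  rw [mixParam]
  field_simp
  linear_combination hs

lemma two_pow_le_one_add_pow {s : ℝ} (hs₀ : 0 ≤ s) (hs₁ : s ≤ 1) {N K : ℕ}
    (hK : (N : ℝ) ≤ s * K) : (2 : ℝ) ^ N ≤ (1 + s) ^ K := by
  calc (2 : ℝ) ^ N = 2 ^ (N : ℝ) := (Real.rpow_natCast _ _).symm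
    _ ≤ 2 ^ (s * K) := Real.rpow_le_rpow_of_exponent_le one_le_two hK
    _ = (2 ^ s) ^ K := Real.rpow_mul_natCast zero_le_two _ _
    _ ≤ (1 + s) ^ K := by
      gcongr
      have := rpow_one_add_le_one_add_mul_self (by norm_num : (-1 : ℝ) ≤ 1) hs₀ hs₁
      rwa [one_add_one_eq_two, mul_one] at this

lemma mixParam_pow_le {lam : ℝ} (hlam₀ : 0 ≤ lam) (hlam₁ : lam < 1) {N K : ℕ}
    (hK : N / √(1 - lam) ≤ K) : mixParam lam ^ K ≤ 1 / 2 ^ N := by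
  have hsqrt : √(1 - lam) ≤ √(1 - lam ^ 2) := Real.sqrt_le_sqrt (by nlinarith)
  rw [div_le_iff₀' (Real.sqrt_pos.2 (sub_pos.2 hlam₁))] at hK
  rw [mixParam, one_div_pow]
  gcongr
  exact two_pow_le_one_add_pow (Real.sqrt_nonneg _) (Real.sqrt_le_one.2 (by nlinarith))
    (hK.trans (by gcongr))

section Rows

variable {m d : ℕ}

/-- The deviation `Π x` of the rows from their average. -/
noncomputable def dev (x : Rows m d) : Rows m d := fun i => x i - avg x

lemma frobSq_nonneg (x : Rows m d) : 0 ≤ frobSq x := Finset.sum_nonneg fun _ _ => sq_nonneg _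

lemma frobSq_smul (c : ℝ) (x : Rows m d) : frobSq (c • x) = c ^ 2 * frobSq x := by
  simp [frobSq, norm_smul, mul_pow, Finset.mul_sum]

lemma frobSq_sub_comm (x y : Rows m d) : frobSq (x - y) = frobSq (y - x) := by
  simp only [frobSq, Pi.sub_apply, norm_sub_rev]

lemma frobSq_add_le (x y : Rows m d) : frobSq (x + y) ≤ 2 * frobSq x + 2 * frobSq y := by
  simp only [frobSq, Finset.mul_sum, ← Finset.sum_add_distrib, Pi.add_apply]
  refine Finset.sum_le_sum fun i _ => ?_
  nlinarith only [parallelogram_law_with_norm ℝ (x i) (y i), sq_nonneg ‖x i - y i‖]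

lemma avg_add (x y : Rows m d) : avg (x + y) = avg x + avg y := by
  simp [avg, Finset.sum_add_distrib]

lemma avg_sub (x y : Rows m d) : avg (x - y) = avg x - avg y := by
  simp [avg, Finset.sum_sub_distrib, smul_sub]

lemma avg_smul (c : ℝ) (x : Rows m d) : avg (c • x) = c • avg x := by
  simp [avg, ← Finset.smul_sum, smul_comm c]

lemma sum_rows (x : Rows m d) : ∑ i, x i = (m : ℝ) • avg x := by
  obtain rfl | hm := eq_or_ne m 0 <;> simp [avg, smul_smul, *]

lemma avg_constRows [NeZero m] (v : Vec d) : avg (constRows m v) = v := by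
  simp [avg, constRows, ← Nat.cast_smul_eq_nsmul ℝ, smul_smul]

lemma dev_add (x y : Rows m d) : dev (x + y) = dev x + dev y := by
  ext1 i
  simp only [dev, avg_add, Pi.add_apply]
  abel

lemma dev_smul (c : ℝ) (x : Rows m d) : dev (c • x) = c • dev x := by
  ext1 i
  simp only [dev, avg_smul, Pi.smul_apply, smul_sub]

lemma dev_constRows (v : Vec d) : dev (constRows m v) = 0 := by
  ext1 i
  have : NeZero m := ⟨i.pos.ne'⟩
  simp [dev, avg_constRows, constRows]

lemma sum_dev (x : Rows m d) : ∑ i, dev x i = 0 := by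
  simp [dev, Finset.sum_sub_distrib, sum_rows, ← Nat.cast_smul_eq_nsmul ℝ]

lemma mulRows_centering (x : Rows m d) : mulRows (centering m) x = dev x := by
  ext1 i
  simp [mulRows, centering, dev, avg, sub_smul, Finset.sum_sub_distrib, Matrix.one_apply,
    ← Finset.smul_sum]

lemma frobSq_sub_constRows (x : Rows m d) (v : Vec d) :
    frobSq (x - constRows m v) = m * ‖avg x - v‖ ^ 2 + frobSq (dev x) := by
  have h : ∀ i, ‖(x - constRows m v) i‖ ^ 2
      = ‖avg x - v‖ ^ 2 + ‖dev x i‖ ^ 2 + 2 * inner ℝ (dev x i) (avg x - v) := by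
    intro i
    rw [show (x - constRows m v) i = dev x i + (avg x - v) by simp [dev, constRows],
      norm_add_sq_real]
    ring
  simp only [frobSq, h, Finset.sum_add_distrib, ← Finset.mul_sum, ← sum_inner, sum_dev]
  simp

lemma frobSq_eq (x : Rows m d) : frobSq x = m * ‖avg x‖ ^ 2 + frobSq (dev x) := by
  simpa [constRows, Pi.sub_def] using frobSq_sub_constRows x 0

lemma frobSq_dev_le (x : Rows m d) : frobSq (dev x) ≤ frobSq x := by
  rw [frobSq_eq x]
  exact le_add_of_nonneg_left (by positivity)

lemma mul_norm_avg_sq_le (x : Rows m d) : m * ‖avg x‖ ^ 2 ≤ frobSq x := by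
  rw [frobSq_eq x]
  exact le_add_of_nonneg_right (frobSq_nonneg _)

lemma frobSq_dev_comb_le (a b : ℝ) (x y : Rows m d) :
    frobSq (dev (a • x + b • y)) ≤ 2 * (a ^ 2 * frobSq (dev x)) + 2 * (b ^ 2 * frobSq (dev y)) := by
  rw [dev_add, dev_smul, dev_smul, ← frobSq_smul, ← frobSq_smul]
  exact frobSq_add_le _ _

/-- The row vector `vᵀ x`; for `v` in an orthonormal basis, the coordinate of the rows along `v`. -/
noncomputable def vecMulRows (v : Fin m → ℝ) (x : Rows m d) : Vec d := ∑ i, v i • x i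

lemma vecMulRows_sub (v : Fin m → ℝ) (x y : Rows m d) :
    vecMulRows v (x - y) = vecMulRows v x - vecMulRows v y := by
  simp [vecMulRows, smul_sub, Finset.sum_sub_distrib]

lemma vecMulRows_smul (v : Fin m → ℝ) (c : ℝ) (x : Rows m d) :
    vecMulRows v (c • x) = c • vecMulRows v x := by
  simp [vecMulRows, Finset.smul_sum, smul_comm c]

lemma vecMulRows_mulRows (v : Fin m → ℝ) (A : Matrix (Fin m) (Fin m) ℝ) (x : Rows m d) :
    vecMulRows v (mulRows A x) = vecMulRows (Matrix.vecMul v A) x := by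
  simp only [vecMulRows, mulRows, Matrix.vecMul, dotProduct, Finset.smul_sum, Finset.sum_smul,
    smul_smul]
  exact Finset.sum_comm

lemma avg_eq_smul_vecMulRows_one (x : Rows m d) : avg x = (1 / (m : ℝ)) • vecMulRows 1 x := by
  simp [avg, vecMulRows]

lemma vecMulRows_dev_of_const (c : ℝ) (x : Rows m d) : vecMulRows (fun _ => c) (dev x) = 0 := by
  rw [vecMulRows, ← Finset.smul_sum, sum_dev, smul_zero]

lemma vecMulRows_dev_of_sum_eq_zero {v : Fin m → ℝ} (hv : ∑ i, v i = 0) (x : Rows m d) :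
    vecMulRows v (dev x) = vecMulRows v x := by
  simp [vecMulRows, dev, smul_sub, Finset.sum_sub_distrib, ← Finset.sum_smul, hv]

lemma sum_norm_vecMulRows_sq (b : OrthonormalBasis (Fin m) ℝ (EuclideanSpace ℝ (Fin m)))
    (x : Rows m d) : ∑ j, ‖vecMulRows (b j) x‖ ^ 2 = frobSq x := by
  have parseval : ∀ l, ∑ j, ‖vecMulRows (b j) x l‖ ^ 2 = ∑ i, ‖x i l‖ ^ 2 := fun l => by
    simpa [EuclideanSpace.norm_sq_eq, vecMulRows, PiLp.inner_apply, mul_comm]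
      using b.sum_sq_norm_inner_right (WithLp.toLp 2 fun i => x i l)
  simp only [frobSq, EuclideanSpace.norm_sq_eq]
  rw [Finset.sum_comm, Finset.sum_comm (s := Finset.univ (α := Fin m))]
  exact Finset.sum_congr rfl fun l _ => parseval l

lemma vecMulRows_fastMix {W : Matrix (Fin m) (Fin m) ℝ} {v : Fin m → ℝ} {μ : ℝ}
    (hv : Matrix.vecMul v W = μ • v) (η : ℝ) (x : Rows m d) :
    ∀ k, vecMulRows v (fastMix W η x k) = mixFactor η μ k • vecMulRows v x
  | 0 => by rw [fastMix, mixFactor, one_smul]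
  | 1 => by rw [fastMix, mixFactor, one_smul]
  | k + 2 => by
    have hmul : ∀ y : Rows m d, vecMulRows v (mulRows W y) = μ • vecMulRows v y := fun y => by
      rw [vecMulRows_mulRows, hv]
      simp [vecMulRows, Finset.smul_sum, smul_smul]
    rw [fastMix, mixFactor, vecMulRows_sub, vecMulRows_smul, vecMulRows_smul, hmul,
      vecMulRows_fastMix hv η x k, vecMulRows_fastMix hv η x (k + 1)]
    module

/-- An averaging operator: it keeps the average of the rows and contracts the squared norm of their
deviations from it by the factor `ρ`. -/
structure IsMixing (ρ : ℝ) (mix : Rows m d → Rows m d) : Prop where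
  avg_eq : ∀ x, avg (mix x) = avg x
  frobSq_dev_mix_le : ∀ x, frobSq (dev (mix x)) ≤ ρ * frobSq (dev x)

lemma IsMixing.mono {ρ ρ' : ℝ} {mix : Rows m d → Rows m d} (hmix : IsMixing ρ mix) (hρ : ρ ≤ ρ') :
    IsMixing ρ' mix :=
  ⟨hmix.avg_eq, fun x =>
    (hmix.frobSq_dev_mix_le x).trans (mul_le_mul_of_nonneg_right hρ (frobSq_nonneg _))⟩

end Rows

namespace IsWeightMatrix

variable {m d : ℕ} {G : SimpleGraph (Fin m)} {W : Matrix (Fin m) (Fin m) ℝ}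

lemma transpose_eq (hW : IsWeightMatrix G W) : W.transpose = W :=
  hW.posSemidef.isHermitian

lemma one_vecMul (hW : IsWeightMatrix G W) : Matrix.vecMul 1 W = 1 := by
  rw [← Matrix.mulVec_transpose, hW.transpose_eq, hW.mulVec_one]

lemma avg_fastMix (hW : IsWeightMatrix G W) (η : ℝ) (x : Rows m d) (k : ℕ) :
    avg (fastMix W η x k) = avg x := by
  rw [avg_eq_smul_vecMulRows_one, vecMulRows_fastMix (hW.one_vecMul.trans (one_smul ℝ 1).symm),
    mixFactor_one, one_smul, ← avg_eq_smul_vecMulRows_one]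
lemma eigenvalue_le_one (hW : IsWeightMatrix G W) (j : Fin m) :
    hW.posSemidef.isHermitian.eigenvalues j ≤ 1 := by
  set hH := hW.posSemidef.isHermitian
  have hnorm : (hH.eigenvectorBasis j : Fin m → ℝ) ⬝ᵥ hH.eigenvectorBasis j = 1 := by
    have := hH.eigenvectorBasis.orthonormal.1 j
    rwa [EuclideanSpace.norm_eq, Real.sqrt_eq_one, ← EuclideanSpace.norm_sq_eq,
      ← real_inner_self_eq_norm_sq, EuclideanSpace.inner_eq_star_dotProduct] at this
  have h := hW.le_one.dotProduct_mulVec_nonneg (hH.eigenvectorBasis j)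
  rw [Matrix.sub_mulVec, Matrix.one_mulVec, hH.mulVec_eigenvectorBasis j, star_trivial,
    dotProduct_sub, dotProduct_smul, hnorm, smul_eq_mul, mul_one] at h
  linarith

lemma exists_eigenvector_eq_const (hW : IsWeightMatrix G W) {j : Fin m}
    (hj : hW.posSemidef.isHermitian.eigenvalues j = 1) :
    ∃ c : ℝ, ⇑(hW.posSemidef.isHermitian.eigenvectorBasis j) = fun _ => c := by
  set hH := hW.posSemidef.isHermitian
  have h : ⇑(hH.eigenvectorBasis j) ∈ LinearMap.ker (Matrix.mulVecLin (1 - W)) := by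
    rw [LinearMap.mem_ker, Matrix.mulVecLin_apply, Matrix.sub_mulVec, Matrix.one_mulVec,
      hH.mulVec_eigenvectorBasis j, hj, one_smul, sub_self]
  rw [hW.null_eq, Submodule.mem_span_singleton] at h
  obtain ⟨c, hc⟩ := h
  exact ⟨c, by rw [← hc]; ext; simp⟩

lemma sum_eigenvector_eq_zero (hW : IsWeightMatrix G W) {j : Fin m}
    (hj : hW.posSemidef.isHermitian.eigenvalues j ≠ 1) :
    ∑ i, hW.posSemidef.isHermitian.eigenvectorBasis j i = 0 := by
  set hH := hW.posSemidef.isHermitian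
  have h := Matrix.dotProduct_mulVec 1 W (hH.eigenvectorBasis j)
  rw [hH.mulVec_eigenvectorBasis j, hW.one_vecMul, dotProduct_smul, one_dotProduct,
    smul_eq_mul] at h
  by_contra hne
  exact hj (mul_right_cancel₀ hne (h.trans (one_mul _).symm))

lemma eq_of_eigenvalues_eq_one (hW : IsWeightMatrix G W) {j k : Fin m}
    (hj : hW.posSemidef.isHermitian.eigenvalues j = 1)
    (hk : hW.posSemidef.isHermitian.eigenvalues k = 1) : j = k := by
  obtain ⟨a, ha⟩ := hW.exists_eigenvector_eq_const hj
  obtain ⟨b, hb⟩ := hW.exists_eigenvector_eq_const hk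
  set B := hW.posSemidef.isHermitian.eigenvectorBasis
  by_contra hne
  have hab : a = 0 ∨ b = 0 := by
    simpa [PiLp.inner_apply, ha, hb, or_comm, j.pos.ne'] using B.orthonormal.2 hne
  obtain rfl | rfl := hab
  · exact B.orthonormal.ne_zero j (PiLp.ext (congrFun ha))
  · exact B.orthonormal.ne_zero k (PiLp.ext (congrFun hb))

lemma exists_eigenvalues_eq_one [NeZero m] (hW : IsWeightMatrix G W) :
    ∃ j, hW.posSemidef.isHermitian.eigenvalues j = 1 := by
  have h : Module.End.HasEigenvector (Matrix.toLin' W) 1 1 :=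
    Module.End.hasEigenvector_iff.2 ⟨by
      rw [Module.End.mem_eigenspace_iff, Matrix.toLin'_apply, hW.mulVec_one, one_smul], one_ne_zero⟩
  have := (Module.End.hasEigenvalue_of_hasEigenvector h).mem_spectrum
  rwa [Matrix.spectrum_toLin', hW.posSemidef.isHermitian.spectrum_real_eq_range_eigenvalues] at this

end IsWeightMatrix

lemma exists_equiv_eigenvalues_eq_eigenvalues₀ {n : Type*} [Fintype n] [DecidableEq n]
    {A : Matrix n n ℝ} (hA : A.IsHermitian) :
    ∃ e : n ≃ Fin (Fintype.card n), ∀ j, hA.eigenvalues j = hA.eigenvalues₀ (e j) :=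
  ⟨(Fintype.equivOfCardEq (Fintype.card_fin _)).symm, fun _ => rfl⟩

namespace IsWeightMatrix

variable {m d : ℕ} {G : SimpleGraph (Fin m)} {W : Matrix (Fin m) (Fin m) ℝ}

lemma eigenvalues₀_eq_one_iff (hW : IsWeightMatrix G W) (k : Fin (Fintype.card (Fin m))) :
    hW.posSemidef.isHermitian.eigenvalues₀ k = 1 ↔ (k : ℕ) = 0 := by
  have : NeZero m := ⟨by simpa using k.pos.ne'⟩
  obtain ⟨j, hj⟩ := hW.exists_eigenvalues_eq_one
  set hH := hW.posSemidef.isHermitian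
  obtain ⟨e, he⟩ := exists_equiv_eigenvalues_eq_eigenvalues₀ hH
  have eq_one_of_zero : ∀ i : Fin (Fintype.card (Fin m)), (i : ℕ) = 0 → hH.eigenvalues₀ i = 1 :=
    fun i hi =>
    le_antisymm (by simpa [he] using hW.eigenvalue_le_one (e.symm i))
      (hj.symm.trans (he j) |>.trans_le (hH.eigenvalues₀_antitone (Fin.le_def.2 (by simp [hi]))))
  refine ⟨fun hk => ?_, eq_one_of_zero k⟩
  have h0 := eq_one_of_zero ⟨0, k.pos⟩ rfl
  have := hW.eq_of_eigenvalues_eq_one (j := e.symm k) (k := e.symm ⟨0, k.pos⟩)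
    (by rw [he, e.apply_symm_apply, hk]) (by rw [he, e.apply_symm_apply, h0])
  exact congrArg Fin.val (e.symm.injective this)

lemma lambda2_nonneg (hm : 2 ≤ m) (hW : IsWeightMatrix G W) :
    0 ≤ lambda2 hm hW.posSemidef.isHermitian := by
  obtain ⟨e, he⟩ := exists_equiv_eigenvalues_eq_eigenvalues₀ hW.posSemidef.isHermitian
  have := hW.posSemidef.eigenvalues_nonneg (e.symm ⟨1, by rw [Fintype.card_fin]; omega⟩)
  rwa [he, e.apply_symm_apply] at this

lemma lambda2_lt_one (hm : 2 ≤ m) (hW : IsWeightMatrix G W) :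
    lambda2 hm hW.posSemidef.isHermitian < 1 := by
  obtain ⟨e, he⟩ := exists_equiv_eigenvalues_eq_eigenvalues₀ hW.posSemidef.isHermitian
  refine lt_of_le_of_ne ?_ fun h => one_ne_zero ((hW.eigenvalues₀_eq_one_iff _).1 h)
  have := hW.eigenvalue_le_one (e.symm ⟨1, by rw [Fintype.card_fin]; omega⟩)
  rwa [he, e.apply_symm_apply] at this

lemma eigenvalues_le_lambda2 (hm : 2 ≤ m) (hW : IsWeightMatrix G W) {j : Fin m}
    (hj : hW.posSemidef.isHermitian.eigenvalues j ≠ 1) :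
    hW.posSemidef.isHermitian.eigenvalues j ≤ lambda2 hm hW.posSemidef.isHermitian := by
  obtain ⟨e, he⟩ := exists_equiv_eigenvalues_eq_eigenvalues₀ hW.posSemidef.isHermitian
  rw [he, ne_eq, hW.eigenvalues₀_eq_one_iff] at hj
  rw [he]
  exact hW.posSemidef.isHermitian.eigenvalues₀_antitone (Fin.le_def.2 (Nat.pos_of_ne_zero hj))

lemma frobSq_dev_fastMix_le (hm : 2 ≤ m) (hW : IsWeightMatrix G W) {lam : ℝ}
    (hlam : lam = lambda2 hm hW.posSemidef.isHermitian) (x : Rows m d) (K : ℕ) :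
    frobSq (dev (fastMix W (mixParam lam) x K)) ≤ 4 * mixParam lam ^ K * frobSq (dev x) := by
  set hH := hW.posSemidef.isHermitian
  have hlam₀ : 0 ≤ lam := hlam ▸ hW.lambda2_nonneg hm
  have hlam₁ : lam < 1 := hlam ▸ hW.lambda2_lt_one hm
  rw [← sum_norm_vecMulRows_sq hH.eigenvectorBasis,
    ← sum_norm_vecMulRows_sq hH.eigenvectorBasis (dev x), Finset.mul_sum]
  refine Finset.sum_le_sum fun j _ => ?_
  by_cases hj : hH.eigenvalues j = 1
  · obtain ⟨c, hc⟩ := hW.exists_eigenvector_eq_const hj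
    simp [hc, vecMulRows_dev_of_const]
  · have hsum := hW.sum_eigenvector_eq_zero hj
    have heigen : Matrix.vecMul (hH.eigenvectorBasis j) W
        = hH.eigenvalues j • ⇑(hH.eigenvectorBasis j) := by
      rw [← Matrix.mulVec_transpose, hW.transpose_eq, hH.mulVec_eigenvectorBasis j]
    rw [vecMulRows_dev_of_sum_eq_zero hsum, vecMulRows_dev_of_sum_eq_zero hsum,
      vecMulRows_fastMix heigen, norm_smul, mul_pow, Real.norm_eq_abs, sq_abs]
    gcongr
    exact mixFactor_sq_le (mixParam_le_one lam) hlam₀ hlam₁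
      (mixParam_sq_mul_sq (pow_le_one₀ hlam₀ hlam₁.le)) (hW.posSemidef.eigenvalues_nonneg j)
      (hlam ▸ hW.eigenvalues_le_lambda2 hm hj) K

lemma isMixing_fastMix (hm : 2 ≤ m) (hW : IsWeightMatrix G W) {lam : ℝ}
    (hlam : lam = lambda2 hm hW.posSemidef.isHermitian) {N K : ℕ} (hK : N / √(1 - lam) ≤ K) :
    IsMixing (4 / 2 ^ N) fun x : Rows m d => fastMix W (mixParam lam) x K where
  avg_eq x := hW.avg_fastMix _ x K
  frobSq_dev_mix_le x := by
    refine (hW.frobSq_dev_fastMix_le hm hlam x K).trans ?_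
    rw [← mul_one_div (4 : ℝ)]
    gcongr
    · exact frobSq_nonneg _
    · exact mixParam_pow_le (hlam ▸ hW.lambda2_nonneg hm) (hlam ▸ hW.lambda2_lt_one hm) hK

end IsWeightMatrix

section Convex

variable {E : Type*} [NormedAddCommGroup E] [InnerProductSpace ℝ E]

lemma norm_sub_sq_le_of_lower_of_upper {φ : E → ℝ} {x y u v : E} {L : ℝ} (hL : 0 < L)
    (lower : ∀ w, φ x + inner ℝ u (w - x) ≤ φ w)
    (upper : ∀ w, φ w ≤ φ y + inner ℝ v (w - y) + L / 2 * ‖w - y‖ ^ 2) :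
    ‖v - u‖ ^ 2 ≤ 2 * L * (φ y - φ x - inner ℝ u (y - x)) := by
  have h := (lower (y - (1 / L) • (v - u))).trans (upper _)
  rw [sub_right_comm, sub_sub_cancel_left, inner_sub_right, inner_neg_right, norm_neg, norm_smul,
    real_inner_smul_right, real_inner_smul_right, mul_pow, Real.norm_eq_abs, sq_abs] at h
  have hsq : (inner ℝ v (v - u) : ℝ) - inner ℝ u (v - u) = ‖v - u‖ ^ 2 := by
    rw [← inner_sub_left, real_inner_self_eq_norm_sq]
  field_simp at h
  nlinarith only [h, hsq, hL]

/-- `p` is a proximal point of `h` at `x`: it minimizes `u ↦ h u + ‖u - x‖² / 2`. -/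
def IsProxPoint (h : E → ℝ) (x p : E) : Prop :=
  ∀ u, h p + 1 / 2 * ‖p - x‖ ^ 2 ≤ h u + 1 / 2 * ‖u - x‖ ^ 2

lemma exists_isProxPoint [FiniteDimensional ℝ E] {h : E → ℝ} (hh : ConvexOn ℝ Set.univ h) (x : E) :
    ∃ p, IsProxPoint h x p := by
  have hcont : Continuous h := continuousOn_univ.1 (hh.continuousOn isOpen_univ)
  obtain ⟨l, c, hle, hx⟩ := hh.exists_affine_le_of_lt (𝕜 := ℝ) (Set.mem_univ x)
    (sub_one_lt (h x)) isClosed_univ (hcont.lowerSemicontinuous.lowerSemicontinuousOn _)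
  have affine_le : ∀ u, h x - 1 + l (u - x) ≤ h u := fun u => by
    have := hle ⟨u, Set.mem_univ u⟩
    simp only [Pi.add_apply, Set.domRestrict_apply, Function.comp_apply, Function.const_apply,
      RCLike.re_to_real] at this hx
    rw [map_sub]
    linarith
  refine Continuous.exists_forall_le_of_isBounded (by fun_prop) x ?_
  refine (Metric.isBounded_closedBall (x := x) (r := 2 * (‖l‖ + 1))).subset fun u hu => ?_
  rw [mem_closedBall_iff_norm]
  have hl := (neg_le_abs _).trans (l.le_opNorm (u - x))
  simp only [Set.mem_ofPred_eq, sub_self, norm_zero] at hu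
  by_contra! hlt
  nlinarith [affine_le u, norm_nonneg l, norm_nonneg (u - x)]

lemma nonneg_of_forall_add_mul_nonneg {a b : ℝ} (h : ∀ θ : ℝ, 0 < θ → θ ≤ 1 → 0 ≤ a + θ * b) :
    0 ≤ a := by
  have hlim : Filter.Tendsto (fun θ => a + θ * b) (nhdsWithin 0 (Set.Ioi 0)) (nhds a) :=
    (Continuous.tendsto' (by fun_prop) 0 a (by simp)).mono_left nhdsWithin_le_nhds
  refine ge_of_tendsto hlim ?_
  filter_upwards [Ioc_mem_nhdsGT zero_lt_one] with θ hθ using h θ hθ.1 hθ.2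

lemma IsProxPoint.sub_le_inner {h : E → ℝ} {x p : E} (hp : IsProxPoint h x p)
    (hh : ConvexOn ℝ Set.univ h) (u : E) : h p - h u ≤ inner ℝ (x - p) (p - u) := by
  suffices 0 ≤ h u - h p + inner ℝ (p - x) (u - p) by
    rw [← neg_sub p x, ← neg_sub u p, inner_neg_neg]
    linarith
  refine nonneg_of_forall_add_mul_nonneg (b := 1 / 2 * ‖u - p‖ ^ 2) fun θ hθ₀ hθ₁ => ?_
  have hmin := hp ((1 - θ) • p + θ • u)
  have hconv := hh.2 (Set.mem_univ p) (Set.mem_univ u) (sub_nonneg.2 hθ₁) hθ₀.le (by ring)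
  rw [show (1 - θ) • p + θ • u - x = (p - x) + θ • (u - p) by module, norm_add_sq_real,
    real_inner_smul_right, norm_smul, mul_pow, Real.norm_eq_abs, sq_abs] at hmin
  simp only [smul_eq_mul] at hconv
  refine nonneg_of_mul_nonneg_right ?_ hθ₀
  linarith

end Convex

namespace IsConvexSmooth

variable {d : ℕ} {L : ℝ} {f : Vec d → ℝ}

lemma norm_gradient_sub_sq_le (hf : IsConvexSmooth L f) (hL : 0 < L) (x y : Vec d) :
    ‖gradient f y - gradient f x‖ ^ 2 ≤ 2 * L * (f y - f x - inner ℝ (gradient f x) (y - x)) :=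
  norm_sub_sq_le_of_lower_of_upper hL (hf.lower x) fun w => norm_sub_rev y w ▸ hf.upper y w

lemma norm_gradient_sub_sq_le_norm_sq (hf : IsConvexSmooth L f) (hL : 0 < L) (x y : Vec d) :
    ‖gradient f y - gradient f x‖ ^ 2 ≤ L ^ 2 * ‖y - x‖ ^ 2 := by
  calc ‖gradient f y - gradient f x‖ ^ 2
      ≤ 2 * L * (f y - f x - inner ℝ (gradient f x) (y - x)) := hf.norm_gradient_sub_sq_le hL x y
    _ ≤ 2 * L * (L / 2 * ‖x - y‖ ^ 2) := by
      gcongr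
      linarith [hf.upper x y]
    _ = L ^ 2 * ‖y - x‖ ^ 2 := by rw [norm_sub_rev]; ring

end IsConvexSmooth

section Prox

variable {m d : ℕ} {γ : ℝ} {g : Vec d → ℝ}

lemma isProxPoint_prox (hγ : 0 ≤ γ) (hg : ConvexOn ℝ Set.univ g) (x : Vec d) :
    IsProxPoint (fun w => γ * g w) x (prox γ g x) :=
  Classical.epsilon_spec (exists_isProxPoint (hg.smul hγ) x)

lemma mul_prox_sub_le_inner (hγ : 0 ≤ γ) (hg : ConvexOn ℝ Set.univ g) (x u : Vec d) :
    γ * (g (prox γ g x) - g u) ≤ inner ℝ (x - prox γ g x) (prox γ g x - u) := by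
  rw [mul_sub]
  exact (isProxPoint_prox hγ hg x).sub_le_inner (hg.smul hγ) u

lemma mul_prox_sub_le (hγ : 0 ≤ γ) (hg : ConvexOn ℝ Set.univ g) (z s u : Vec d) {p : Vec d}
    (hp : p = prox γ g (z - γ • s)) :
    γ * (g p - g u) ≤
      1 / 2 * (‖z - u‖ ^ 2 - ‖p - u‖ ^ 2 - ‖p - z‖ ^ 2) - γ * inner ℝ s (p - u) := by
  have h := mul_prox_sub_le_inner hγ hg (z - γ • s) u
  rw [← hp, show z - γ • s - p = ((z - u) - (p - u)) - γ • s by abel, inner_sub_left,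
    inner_sub_left, real_inner_smul_left, real_inner_self_eq_norm_sq] at h
  rw [show p - z = (p - u) - (z - u) by abel, norm_sub_sq_real (p - u),
    real_inner_comm (z - u)]
  linarith

end Prox

section LinearModel

variable {m d : ℕ} {L : ℝ} {f : Fin m → Vec d → ℝ}

/-- The first-order model `u ↦ ∑ᵢ (fᵢ(xⁱ) + ⟨∇fᵢ(xⁱ), u - xⁱ⟩)` of `∑ᵢ fᵢ`, in which every agent
linearizes at its own row of `x`. -/
noncomputable def linModel (f : Fin m → Vec d → ℝ) (x : Rows m d) (u : Vec d) : ℝ :=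
  ∑ i, (f i (x i) + inner ℝ (gradRows f x i) (u - x i))

lemma linModel_le (hf : ∀ i, IsConvexSmooth L (f i)) (x : Rows m d) (u : Vec d) :
    linModel f x u ≤ ∑ i, f i u :=
  Finset.sum_le_sum fun i _ => (hf i).lower (x i) u

lemma sum_le_linModel_add (hf : ∀ i, IsConvexSmooth L (f i)) (x : Rows m d) (u : Vec d) :
    ∑ i, f i u ≤ linModel f x u + L / 2 * frobSq (x - constRows m u) := by
  rw [linModel, frobSq, Finset.mul_sum, ← Finset.sum_add_distrib]
  exact Finset.sum_le_sum fun i _ => (hf i).upper (x i) u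

lemma linModel_add_frobSq_le (hL : 0 < L) (hf : ∀ i, IsConvexSmooth L (f i)) (x : Rows m d)
    (u : Vec d) :
    linModel f x u + 1 / (2 * L) * frobSq (gradRows f (constRows m u) - gradRows f x)
      ≤ ∑ i, f i u := by
  rw [linModel, frobSq, Finset.mul_sum, ← Finset.sum_add_distrib]
  refine Finset.sum_le_sum fun i _ => ?_
  have h := (inv_mul_le_iff₀ (by positivity)).2 ((hf i).norm_gradient_sub_sq_le hL (x i) u)
  simp only [gradRows, constRows, Pi.sub_apply, one_div]
  linarith

lemma linModel_eq_add (f : Fin m → Vec d → ℝ) (x : Rows m d) (u v : Vec d) :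
    linModel f x v = linModel f x u + m * inner ℝ (avg (gradRows f x)) (v - u) := by
  rw [← real_inner_smul_left, ← sum_rows, sum_inner, linModel, linModel, ← Finset.sum_add_distrib]
  refine Finset.sum_congr rfl fun i _ => ?_
  rw [add_assoc, ← inner_add_right, add_comm (u - x i), sub_add_sub_cancel]

lemma linModel_comb (f : Fin m → Vec d → ℝ) (x : Rows m d) (τ : ℝ) (u v : Vec d) :
    linModel f x (τ • u + (1 - τ) • v) = τ * linModel f x u + (1 - τ) * linModel f x v := by
  rw [linModel_eq_add f x v (τ • u + (1 - τ) • v), linModel_eq_add f x v u,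
    show τ • u + (1 - τ) • v - v = τ • (u - v) by module, real_inner_smul_right]
  ring

lemma frobSq_gradRows_sub_le (hL : 0 < L) (hf : ∀ i, IsConvexSmooth L (f i)) (x y : Rows m d) :
    frobSq (gradRows f y - gradRows f x) ≤ L ^ 2 * frobSq (y - x) := by
  simp only [frobSq, Finset.mul_sum]
  exact Finset.sum_le_sum fun i _ => (hf i).norm_gradient_sub_sq_le_norm_sq hL _ _

lemma sum_comb_le (hL : 0 < L) (hf : ∀ i, IsConvexSmooth L (f i)) {τ : ℝ} (hτ₀ : 0 ≤ τ)
    (hτ₁ : τ ≤ 1) (x : Rows m d) (u v w : Vec d) :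
    ∑ i, f i (τ • w + (1 - τ) • v) ≤
      τ * (∑ i, f i u + m * inner ℝ (avg (gradRows f x)) (w - u))
      + (1 - τ) * (∑ i, f i v
        - 1 / (2 * L) * frobSq (gradRows f (constRows m v) - gradRows f x))
      + L / 2 * frobSq (x - constRows m (τ • w + (1 - τ) • v)) := by
  refine (sum_le_linModel_add hf x _).trans ?_
  have := sub_nonneg.2 hτ₁
  rw [linModel_comb, linModel_eq_add f x u w]
  gcongr
  · exact linModel_le hf x u
  · exact le_sub_iff_add_le.2 (linModel_add_frobSq_le hL hf x v)

end LinearModel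

section ProximalStep

variable {m d : ℕ} {g : Vec d → ℝ}

lemma mul_objective (f : Fin m → Vec d → ℝ) (g : Vec d → ℝ) (x : Vec d) :
    m * objective f g x = ∑ i, f i x + m * g x := by
  obtain rfl | hm := eq_or_ne m 0
  · simp
  · rw [objective]
    field_simp

lemma mul_map_avg_le (hg : ConvexOn ℝ Set.univ g) (p : Rows m d) :
    m * g (avg p) ≤ ∑ i, g (p i) := by
  obtain rfl | hm := eq_or_ne m 0
  · simp
  have h := hg.map_sum_le (t := Finset.univ) (w := fun _ : Fin m => 1 / (m : ℝ)) (p := p)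
    (fun _ _ => by positivity) (by simp [hm]) (fun _ _ => Set.mem_univ _)
  rw [← Finset.smul_sum, ← Finset.smul_sum, smul_eq_mul, one_div_mul_eq_div,
    le_div_iff₀' (by positivity)] at h
  exact h

lemma sum_inner_eq (s p : Rows m d) (u : Vec d) :
    ∑ i, inner ℝ (s i) (p i - u)
      = m * inner ℝ (avg s) (avg p - u) + ∑ i, (inner ℝ (dev s i) (dev p i) : ℝ) := by
  have h : ∀ i, inner ℝ (s i) (p i - u) = inner ℝ (avg s) (avg p - u)
      + inner ℝ (avg s) (dev p i) + inner ℝ (dev s i) (avg p - u)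
      + (inner ℝ (dev s i) (dev p i) : ℝ) := by
    intro i
    rw [show s i = avg s + dev s i by simp [dev],
      show p i - u = (avg p - u) + dev p i by simp [dev],
      inner_add_left, inner_add_right, inner_add_right]
    ring
  simp only [h, Finset.sum_add_distrib, ← sum_inner, ← inner_sum, sum_dev]
  simp [← Nat.cast_smul_eq_nsmul ℝ, real_inner_smul_left]

lemma neg_mul_sum_inner_le (γ : ℝ) (s p : Rows m d) :
    -(γ * ∑ i, (inner ℝ (s i) (p i) : ℝ)) ≤ γ ^ 2 * frobSq s + 1 / 4 * frobSq p := by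
  have h := frobSq_nonneg (γ • s + (1 / 2 : ℝ) • p)
  simp only [frobSq, Pi.add_apply, Pi.smul_apply, norm_add_sq_real, norm_smul, mul_pow,
    Real.norm_eq_abs, sq_abs, real_inner_smul_left, real_inner_smul_right, Finset.sum_add_distrib,
    ← Finset.mul_sum] at h
  simp only [frobSq]
  linarith

lemma sum_prox_le {γ : ℝ} (hγ : 0 ≤ γ) (hg : ConvexOn ℝ Set.univ g) (z s : Rows m d) (u : Vec d)
    {p : Rows m d} (hp : p = proxRows γ g (z - γ • s)) :
    γ * (∑ i, g (p i) - m * g u + m * inner ℝ (avg s) (avg p - u)) ≤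
      1 / 2 * (frobSq (z - constRows m u) - frobSq (p - constRows m u)
        - m * ‖avg p - avg z‖ ^ 2) + γ ^ 2 * frobSq (dev s) + 1 / 4 * frobSq (dev p) := by
  have hsum := Finset.sum_le_sum fun i (_ : i ∈ Finset.univ) =>
    mul_prox_sub_le hγ hg (z i) (s i) u (congrFun hp i)
  simp only [← Finset.mul_sum, Finset.sum_sub_distrib, sum_inner_eq, Finset.sum_const,
    Finset.card_univ, Fintype.card_fin, nsmul_eq_mul] at hsum
  have hmove := mul_norm_avg_sq_le (p - z)
  have hyoung := neg_mul_sum_inner_le γ (dev s) (dev p)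
  rw [avg_sub] at hmove
  simp only [frobSq, Pi.sub_apply, constRows] at hsum hmove hyoung ⊢
  linarith

lemma mul_map_comb_avg_le (hg : ConvexOn ℝ Set.univ g) {τ : ℝ} (hτ₀ : 0 ≤ τ) (hτ₁ : τ ≤ 1)
    (p : Rows m d) (v : Vec d) :
    m * g (τ • avg p + (1 - τ) • v) ≤ τ * ∑ i, g (p i) + (1 - τ) * (m * g v) := by
  calc m * g (τ • avg p + (1 - τ) • v) ≤ m * (τ * g (avg p) + (1 - τ) * g v) := by
        gcongr
        exact hg.2 (Set.mem_univ _) (Set.mem_univ _) hτ₀ (sub_nonneg.2 hτ₁) (by ring)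
    _ = τ * (m * g (avg p)) + (1 - τ) * (m * g v) := by ring
    _ ≤ τ * ∑ i, g (p i) + (1 - τ) * (m * g v) := by
        gcongr
        exact mul_map_avg_le hg p

lemma frobSq_comb_sub_constRows (τ : ℝ) (z y : Rows m d) (w : Vec d) :
    frobSq (τ • z + (1 - τ) • y - constRows m (τ • w + (1 - τ) • avg y))
      = τ ^ 2 * (m * ‖w - avg z‖ ^ 2) + frobSq (dev (τ • z + (1 - τ) • y)) := by
  rw [frobSq_sub_constRows, avg_add, avg_smul, avg_smul, add_sub_add_right_eq_sub, ← smul_sub,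
    norm_smul, mul_pow, Real.norm_eq_abs, sq_abs, norm_sub_rev]
  ring

lemma mul_objective_sub_le {L : ℝ} (hL : 0 < L) {f : Fin m → Vec d → ℝ}
    (hf : ∀ i, IsConvexSmooth L (f i)) (hg : ConvexOn ℝ Set.univ g) {γ τ : ℝ} (hγ : 0 < γ)
    (hτ₀ : 0 ≤ τ) (hτ₁ : τ ≤ 1) (u : Vec d) {x y z s p : Rows m d}
    (hx : x = τ • z + (1 - τ) • y) (hs : avg s = avg (gradRows f x))
    (hp : p = proxRows γ g (z - γ • s)) :
    m * (objective f g (τ • avg p + (1 - τ) • avg y) - objective f g u) ≤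
      (1 - τ) * (m * (objective f g (avg y) - objective f g u))
      + τ / γ * (1 / 2 * (frobSq (z - constRows m u) - frobSq (p - constRows m u)
        - m * ‖avg p - avg z‖ ^ 2) + γ ^ 2 * frobSq (dev s) + 1 / 4 * frobSq (dev p))
      + L / 2 * (τ ^ 2 * (m * ‖avg p - avg z‖ ^ 2) + frobSq (dev x))
      - (1 - τ) / (2 * L) * frobSq (gradRows f (constRows m (avg y)) - gradRows f x) := by
  have hsmooth := sum_comb_le hL hf hτ₀ hτ₁ x u (avg y) (avg p)
  have hprox := mul_le_mul_of_nonneg_left (sum_prox_le hγ.le hg z s u hp) (div_nonneg hτ₀ hγ.le)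
  have hconv := mul_map_comb_avg_le hg hτ₀ hτ₁ p (avg y)
  rw [← mul_assoc, div_mul_cancel₀ _ hγ.ne', hs] at hprox
  have hdist := frobSq_comb_sub_constRows τ z y (avg p)
  rw [← hx] at hdist
  simp only [mul_sub (m : ℝ), mul_objective]
  linear_combination hsmooth + hprox + hconv + L / 2 * hdist

end ProximalStep

section Step

variable {m d : ℕ} {ρ L c γ τ γ' τ' : ℝ} {mix : Rows m d → Rows m d} {f : Fin m → Vec d → ℝ}
  {g : Vec d → ℝ}

namespace IsMixing

lemma avg_step_s (hmix : IsMixing ρ mix) {S : State m d} (hs : avg S.s = avg (gradRows f S.x)) :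
    avg (step mix f g γ τ S).s = avg (gradRows f (step mix f g γ τ S).x) := by
  simp only [step, hmix.avg_eq, avg_sub, avg_add, hs, add_sub_cancel_left]

lemma avg_step_y (hmix : IsMixing ρ mix) (S : State m d) :
    avg (step mix f g γ τ S).y = τ • avg (step mix f g γ τ S).z + (1 - τ) • avg S.y := by
  simp only [step, hmix.avg_eq, avg_add, avg_smul]

lemma frobSq_dev_step_s_le (hmix : IsMixing ρ mix) (hρ : 0 ≤ ρ) (hL : 0 < L)
    (hf : ∀ i, IsConvexSmooth L (f i)) (S : State m d) :
    frobSq (dev (step mix f g γ τ S).s) ≤ ρ * (4 * frobSq (dev S.s)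
      + 4 * frobSq (gradRows f (constRows m (avg S.y)) - gradRows f (step mix f g γ τ S).x)
      + 2 * (L ^ 2 * frobSq (S.x - constRows m (avg S.y)))) := by
  set x' := (step mix f g γ τ S).x
  refine (hmix.frobSq_dev_mix_le (S.s + gradRows f x' - gradRows f S.x)).trans
    (mul_le_mul_of_nonneg_left ?_ hρ)
  set v := constRows m (avg S.y)
  have hsplit : S.s + gradRows f x' - gradRows f S.x
      = (S.s + (gradRows f x' - gradRows f v)) + (gradRows f v - gradRows f S.x) := by abel
  rw [hsplit, dev_add, dev_add]
  have h₁ := frobSq_add_le (dev S.s + dev (gradRows f x' - gradRows f v))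
    (dev (gradRows f v - gradRows f S.x))
  have h₂ := frobSq_add_le (dev S.s) (dev (gradRows f x' - gradRows f v))
  have h₃ := frobSq_dev_le (gradRows f x' - gradRows f v)
  have h₄ := (frobSq_dev_le (gradRows f v - gradRows f S.x)).trans
    (frobSq_gradRows_sub_le hL hf S.x v)
  rw [frobSq_sub_comm] at h₃ h₄
  linarith

end IsMixing

lemma frobSq_dev_comb_div_le (hτ₀ : 0 < τ) (hτ₁ : τ ≤ 1) (z y : Rows m d) :
    frobSq (dev (τ • z + (1 - τ) • y)) / τ ^ 2
      ≤ 2 * frobSq (dev z) + 2 * ((1 - τ) / τ ^ 2 * frobSq (dev y)) := by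
  have hsq : (1 - τ) ^ 2 ≤ 1 - τ := by nlinarith
  rw [div_le_iff₀ (by positivity)]
  calc frobSq (dev (τ • z + (1 - τ) • y))
      ≤ 2 * (τ ^ 2 * frobSq (dev z)) + 2 * ((1 - τ) ^ 2 * frobSq (dev y)) :=
        frobSq_dev_comb_le τ (1 - τ) z y
    _ ≤ 2 * (τ ^ 2 * frobSq (dev z)) + 2 * ((1 - τ) * frobSq (dev y)) := by
        gcongr
        exact frobSq_nonneg _
    _ = (2 * frobSq (dev z) + 2 * ((1 - τ) / τ ^ 2 * frobSq (dev y))) * τ ^ 2 := by field_simp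

/-- The quantities that govern the inexactness of one step: how far the tracked gradients, the query
points, the proximal points and the outputs are from consensus, how far the average of `z` moves,
and how much the local gradients at the query points differ from those at the average of `y`. -/
structure StepErrors where
  tracking : ℝ
  query : ℝ
  prox : ℝ
  move : ℝ
  residual : ℝ
  output : ℝ

/-- The errors of the step from `S` to `S'`, scaled so that the constants of the recursion between
consecutive steps do not depend on the step sizes. -/
noncomputable def stepErrors (f : Fin m → Vec d → ℝ) (g : Vec d → ℝ) (c γ τ : ℝ)
    (S S' : State m d) : StepErrors where
  tracking := c * γ ^ 2 * frobSq (dev S'.s)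
  query := frobSq (dev S'.x) / τ ^ 2
  prox := frobSq (dev (proxRows γ g (S.z - γ • S'.s)))
  move := m * ‖avg S'.z - avg S.z‖ ^ 2
  residual := (c * γ) ^ 2 * frobSq (gradRows f (constRows m (avg S.y)) - gradRows f S'.x)
  output := frobSq (dev S'.y) / τ ^ 2

namespace StepErrors

/-- All errors are nonnegative. -/
structure IsNonneg (e : StepErrors) : Prop where
  tracking : 0 ≤ e.tracking
  query : 0 ≤ e.query
  prox : 0 ≤ e.prox
  move : 0 ≤ e.move
  residual : 0 ≤ e.residual
  output : 0 ≤ e.output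

/-- The contribution of the errors of one step to the decrease of the Lyapunov function. -/
noncomputable def total (e : StepErrors) : ℝ :=
  e.tracking + e.query / 2 - 7 / 16 * e.prox - e.move / 2 - e.residual / 4

/-- The potential that pays for the contributions of all later steps. -/
noncomputable def potential (e : StepErrors) : ℝ :=
  e.tracking + e.query / 2 + e.move / 4 + e.prox / 4 + 3 * e.output

/-- The recursion satisfied by the errors `e`, `e'` of two consecutive steps. -/
structure Follows (e e' : StepErrors) : Prop where
  tracking_le : e'.tracking ≤ e.tracking / 2 + (e.move + e.query) / 8 + e'.residual / 8
  query_le : e'.query ≤ e.prox / 8 + 2 * e.output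
  output_le : e'.output ≤ e'.prox / 128 + e.output / 8

variable {e e' : StepErrors}

lemma IsNonneg.potential_nonneg (he : e.IsNonneg) : 0 ≤ e.potential := by
  rw [potential]
  linarith [he.tracking, he.query, he.move, he.prox, he.output]

lemma Follows.total_add_potential_le (h : Follows e e') (he : e.IsNonneg) (he' : e'.IsNonneg) :
    e'.total + e'.potential ≤ e.potential := by
  rw [total, potential, potential]
  linarith [h.tracking_le, h.query_le, h.output_le, he.query, he.prox, he.output, he'.prox,
    he'.move]

lemma IsNonneg.total_add_potential_le (he : e.IsNonneg) (hquery : e.query = 0)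
    (houtput : e.output ≤ e.prox / 128) : e.total + e.potential ≤ 2 * e.tracking := by
  rw [total, potential]
  linarith [he.prox, he.move, he.residual]

end StepErrors

lemma isNonneg_stepErrors (hc : 0 ≤ c) (S S' : State m d) :
    (stepErrors f g c γ τ S S').IsNonneg where
  tracking := mul_nonneg (by positivity) (frobSq_nonneg _)
  query := div_nonneg (frobSq_nonneg _) (sq_nonneg _)
  prox := frobSq_nonneg _
  move := by simp only [stepErrors]; positivity
  residual := mul_nonneg (sq_nonneg _) (frobSq_nonneg _)
  output := div_nonneg (frobSq_nonneg _) (sq_nonneg _)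

namespace IsMixing

variable {S S' S'' : State m d}

lemma frobSq_step_x_sub (hmix : IsMixing ρ mix) (hτ : τ ≠ 0) (hS' : S' = step mix f g γ τ S) :
    frobSq (S'.x - constRows m (avg S'.y)) = τ ^ 2 *
      ((stepErrors f g c γ τ S S').move + (stepErrors f g c γ τ S S').query) := by
  have hy : avg S'.y = τ • avg S'.z + (1 - τ) • avg S.y := hS' ▸ hmix.avg_step_y S
  have hx : S'.x = τ • S.z + (1 - τ) • S.y := by rw [hS', step]
  simp only [stepErrors]
  rw [mul_add, mul_div_cancel₀ _ (pow_ne_zero 2 hτ), hy, hx, frobSq_comb_sub_constRows]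

lemma tracking_le (hmix : IsMixing (1 / 16) mix) (hL : 0 < L)
    (hf : ∀ i, IsConvexSmooth L (f i)) (hc : 2 ≤ c) (hγτ : L * c * γ * τ = 1)
    (hγ : γ' ^ 2 ≤ 2 * γ ^ 2) (hS' : S' = step mix f g γ τ S)
    (hS'' : S'' = step mix f g γ' τ' S') :
    (stepErrors f g c γ' τ' S' S'').tracking ≤ (stepErrors f g c γ τ S S').tracking / 2
      + ((stepErrors f g c γ τ S S').move + (stepErrors f g c γ τ S S').query) / 8
      + (stepErrors f g c γ' τ' S' S'').residual / 8 := by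
  have he := isNonneg_stepErrors (f := f) (g := g) (γ := γ) (τ := τ) (by linarith : 0 ≤ c) S S'
  have hs := hmix.frobSq_dev_step_s_le (g := g) (γ := γ') (τ := τ') (by norm_num) hL hf S'
  rw [← hS'', hmix.frobSq_step_x_sub (c := c) (right_ne_zero_of_mul_eq_one hγτ) hS'] at hs
  have hM := add_nonneg he.move he.query
  set M := (stepErrors f g c γ τ S S').move + (stepErrors f g c γ τ S S').query
  simp only [stepErrors]
  set σ := frobSq (dev S'.s)
  set Q := frobSq (gradRows f (constRows m (avg S'.y)) - gradRows f S''.x)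
  have hσ₀ : 0 ≤ σ := frobSq_nonneg _
  have hQ₀ : 0 ≤ Q := frobSq_nonneg _
  have hσ : c * γ' ^ 2 * σ ≤ c * (2 * γ ^ 2) * σ := by gcongr
  have hQ : 2 * c * γ' ^ 2 * Q ≤ (c * γ') ^ 2 * Q := by
    rw [mul_pow, sq c]
    gcongr
  have hstep : c * γ' ^ 2 * (L ^ 2 * τ ^ 2) ≤ 1 := by
    calc c * γ' ^ 2 * (L ^ 2 * τ ^ 2) ≤ c * (2 * γ ^ 2) * (L ^ 2 * τ ^ 2) := by gcongr
      _ = 2 * c * (L * γ * τ) ^ 2 := by ring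
      _ ≤ c * c * (L * γ * τ) ^ 2 := by gcongr
      _ = 1 := by linear_combination (L * c * γ * τ + 1) * hγτ
  calc c * γ' ^ 2 * frobSq (dev S''.s)
      ≤ c * γ' ^ 2 * (1 / 16 * (4 * σ + 4 * Q + 2 * (L ^ 2 * (τ ^ 2 * M)))) := by gcongr
    _ ≤ c * γ ^ 2 * σ / 2 + M / 8 + (c * γ') ^ 2 * Q / 8 := by
      linarith [mul_le_mul_of_nonneg_right hstep hM]

lemma output_le (hmix : IsMixing (1 / 16) mix) (hτ₀ : 0 < τ) (hτ₁ : τ ≤ 1)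
    (hS' : S' = step mix f g γ τ S) :
    (stepErrors f g c γ τ S S').output ≤ (stepErrors f g c γ τ S S').prox / 128
      + (1 - τ) / τ ^ 2 * frobSq (dev S.y) / 8 := by
  have hz : frobSq (dev S'.z) ≤ 1 / 16 * (stepErrors f g c γ τ S S').prox := by
    rw [hS']
    exact hmix.frobSq_dev_mix_le _
  have hy : (stepErrors f g c γ τ S S').output
      ≤ 1 / 16 * (frobSq (dev (τ • S'.z + (1 - τ) • S.y)) / τ ^ 2) := by
    rw [← mul_div_assoc, hS']
    exact div_le_div_of_nonneg_right (hmix.frobSq_dev_mix_le _) (sq_nonneg _)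
  linarith [frobSq_dev_comb_div_le hτ₀ hτ₁ S'.z S.y]

lemma follows_stepErrors (hmix : IsMixing (1 / 16) mix) (hL : 0 < L)
    (hf : ∀ i, IsConvexSmooth L (f i)) (hc : 2 ≤ c) (hγτ : L * c * γ * τ = 1)
    (hγ : γ' ^ 2 ≤ 2 * γ ^ 2) (hτ'₀ : 0 < τ') (hτ'₁ : τ' ≤ 1)
    (hττ' : (1 - τ') / τ' ^ 2 ≤ 1 / τ ^ 2) (hS' : S' = step mix f g γ τ S)
    (hS'' : S'' = step mix f g γ' τ' S') :
    (stepErrors f g c γ τ S S').Follows (stepErrors f g c γ' τ' S' S'') := by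
  have hz : frobSq (dev S'.z) ≤ 1 / 16 * (stepErrors f g c γ τ S S').prox := by
    rw [hS']
    exact hmix.frobSq_dev_mix_le _
  have hy : (1 - τ') / τ' ^ 2 * frobSq (dev S'.y) ≤ (stepErrors f g c γ τ S S').output :=
    (mul_le_mul_of_nonneg_right hττ' (frobSq_nonneg _)).trans_eq (one_div_mul_eq_div _ _)
  refine ⟨hmix.tracking_le hL hf hc hγτ hγ hS' hS'', ?_, ?_⟩
  · have hquery := frobSq_dev_comb_div_le hτ'₀ hτ'₁ S'.z S'.y
    have hx : S''.x = τ' • S'.z + (1 - τ') • S'.y := by rw [hS'', step]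
    rw [← hx] at hquery
    exact hquery.trans (by linarith)
  · linarith [hmix.output_le (c := c) hτ'₀ hτ'₁ hS'']

lemma total_add_potential_init_le (hmix : IsMixing ρ mix) (hρ : ρ ≤ 1 / 16) (hc : 0 ≤ c)
    (hτ₀ : 0 < τ) (hτ₁ : τ ≤ 1) (x₁ : Vec d) (hS' : S' = step mix f g γ τ (initState f x₁)) :
    (stepErrors f g c γ τ (initState f x₁) S').total
      + (stepErrors f g c γ τ (initState f x₁) S').potential
      ≤ 2 * (c * γ ^ 2 * (ρ * frobSq (dev (initState f x₁ : State m d).s))) := by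
  set S : State m d := initState f x₁
  have hx : S'.x = S.x := by
    simp only [hS', step, S, initState]
    module
  have htracking : frobSq (dev S'.s) ≤ ρ * frobSq (dev S.s) := by
    have : S'.s = mix (S.s + gradRows f S'.x - gradRows f S.x) := by rw [hS', step]
    rw [this, hx, add_sub_cancel_right]
    exact hmix.frobSq_dev_mix_le _
  have hquery : (stepErrors f g c γ τ S S').query = 0 := by
    simp [stepErrors, hx, S, initState, dev_constRows, frobSq]
  have houtput : (stepErrors f g c γ τ S S').output
      ≤ (stepErrors f g c γ τ S S').prox / 128 := by
    have h := (hmix.mono hρ).output_le (c := c) hτ₀ hτ₁ hS'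
    simpa [S, initState, dev_constRows, frobSq] using h
  refine ((isNonneg_stepErrors hc S S').total_add_potential_le hquery houtput).trans ?_
  simp only [stepErrors]
  gcongr

end IsMixing

lemma gap_step_le (hmix : IsMixing ρ mix) (hL : 0 < L) (hf : ∀ i, IsConvexSmooth L (f i))
    (hg : ConvexOn ℝ Set.univ g) (hγ : 0 < γ) (hτ₀ : 0 < τ) (hτ₁ : τ ≤ 1)
    (hγτ : L * c * γ * τ = 1) (u : Vec d) {S S' : State m d}
    (hs : avg S.s = avg (gradRows f S.x)) (hS' : S' = step mix f g γ τ S) {e : StepErrors}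
    (he : e = stepErrors f g c γ τ S S') :
    m * (objective f g (avg S'.y) - objective f g u) / τ ^ 2 ≤
      (1 - τ) / τ ^ 2 * (m * (objective f g (avg S.y) - objective f g u))
        + L * c / 2 * (frobSq (S.z - constRows m u)
          - frobSq (proxRows γ g (S.z - γ • S'.s) - constRows m u))
        + L * (e.tracking + e.query / 2 + c / 4 * e.prox - (c - 1) / 2 * e.move
          - (1 - τ) / 2 * e.residual) := by
  set p := proxRows γ g (S.z - γ • S'.s) with hp
  have hz : avg S'.z = avg p := by rw [← hmix.avg_eq p, hp, hS', step]
  have hx : S'.x = τ • S.z + (1 - τ) • S.y := by rw [hS', step]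
  have hs' : avg S'.s = avg (gradRows f S'.x) := hS' ▸ hmix.avg_step_s hs
  have hy : avg S'.y = τ • avg p + (1 - τ) • avg S.y := by rw [← hz, hS', hmix.avg_step_y]
  have h := mul_objective_sub_le hL hf hg hγ hτ₀.le hτ₁ u hx hs' hp
  have hdiv : τ / γ = L * c * τ ^ 2 := by
    field_simp
    linear_combination -hγτ
  have hinv : (1 - τ) / (2 * L) = (1 - τ) / 2 * L * (c * γ * τ) ^ 2 := by
    rw [div_eq_iff (by positivity)]
    linear_combination (τ - 1) * (L * c * γ * τ + 1) * hγτ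
  rw [← hy, hdiv, hinv] at h
  rw [div_le_iff₀ (by positivity)]
  refine h.trans_eq ?_
  simp only [he, stepErrors, ← hp, hz]
  field_simp
  ring

lemma lyapunov_step_le (hmix : IsMixing (1 / 16) mix) (hL : 0 < L)
    (hf : ∀ i, IsConvexSmooth L (f i)) (hg : ConvexOn ℝ Set.univ g) (hc : 2 ≤ c) (hγ : 0 < γ)
    (hτ₀ : 0 < τ) (hτ₁ : τ ≤ 1 / 2) (hγτ : L * c * γ * τ = 1) (u : Vec d) {S S' : State m d}
    (hs : avg S.s = avg (gradRows f S.x)) (hS' : S' = step mix f g γ τ S) :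
    m * (objective f g (avg S'.y) - objective f g u) / τ ^ 2
        + L * c / 2 * frobSq (S'.z - constRows m u) ≤
      (1 - τ) / τ ^ 2 * (m * (objective f g (avg S.y) - objective f g u))
        + L * c / 2 * frobSq (S.z - constRows m u) + L * (stepErrors f g c γ τ S S').total := by
  have hgap := gap_step_le hmix hL hf hg hγ hτ₀ (by linarith) hγτ u hs hS' rfl
  have he := isNonneg_stepErrors (f := f) (g := g) (γ := γ) (τ := τ) (by linarith : 0 ≤ c) S S'
  have hz : frobSq (S'.z - constRows m u) + 15 / 16 * (stepErrors f g c γ τ S S').prox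
      ≤ frobSq (proxRows γ g (S.z - γ • S'.s) - constRows m u) := by
    have hmixed : S'.z = mix (proxRows γ g (S.z - γ • S'.s)) := by rw [hS', step]
    have := hmix.frobSq_dev_mix_le (proxRows γ g (S.z - γ • S'.s))
    rw [hmixed, frobSq_sub_constRows, frobSq_sub_constRows, hmix.avg_eq]
    simp only [stepErrors]
    linarith
  have hLc : 0 ≤ L * c / 2 := by positivity
  set e := stepErrors f g c γ τ S S'
  have hprox : 0 ≤ (c - 2) * e.prox := mul_nonneg (sub_nonneg.2 hc) he.prox
  have hmove : 0 ≤ (c - 2) * e.move := mul_nonneg (sub_nonneg.2 hc) he.move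
  have hresidual : 0 ≤ (1 / 2 - τ) * e.residual := mul_nonneg (sub_nonneg.2 hτ₁) he.residual
  have hslack : e.tracking + e.query / 2 + c / 4 * e.prox - (c - 1) / 2 * e.move
      - (1 - τ) / 2 * e.residual - 15 / 32 * c * e.prox ≤ e.total := by
    rw [StepErrors.total]
    linarith
  linarith [mul_le_mul_of_nonneg_left hz hLc, mul_le_mul_of_nonneg_left hslack hL.le]

end Step

section Rate

variable {m d : ℕ} {ρ L c : ℝ} {mix : Rows m d → Rows m d} {f : Fin m → Vec d → ℝ} {g : Vec d → ℝ}
  {γ τ : ℕ → ℝ} {x₁ : Vec d} {S : ℕ → State m d}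

/-- Step sizes for which the accelerated scheme converges with momentum `τ` and constant `c`. -/
structure IsStepSchedule (L c : ℝ) (γ τ : ℕ → ℝ) : Prop where
  pos : ∀ n, 0 < τ n
  le_half : ∀ n, τ n ≤ 1 / 2
  mul_eq_one : ∀ n, L * c * γ n * τ n = 1
  one_sub_div_le : ∀ n, (1 - τ (n + 1)) / τ (n + 1) ^ 2 ≤ 1 / τ n ^ 2
  sq_le : ∀ n, γ (n + 1) ^ 2 ≤ 2 * γ n ^ 2

namespace IsStepSchedule

lemma step_pos (h : IsStepSchedule L c γ τ) (hL : 0 < L) (hc : 0 < c) (n : ℕ) : 0 < γ n := by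
  have hprod : 0 < L * c * γ n := pos_of_mul_pos_left (h.mul_eq_one n ▸ one_pos) (h.pos n).le
  exact pos_of_mul_pos_right hprod (by positivity)

lemma weighted_gap_le (h : IsStepSchedule L c γ τ) (hL : 0 < L) (hc : 2 ≤ c)
    (hmix : IsMixing ρ mix) (hρ : ρ ≤ 1 / 16) (hf : ∀ i, IsConvexSmooth L (f i))
    (hg : ConvexOn ℝ Set.univ g) {u : Vec d} (hu : ∀ x, objective f g u ≤ objective f g x)
    (hS₀ : S 0 = initState f x₁) (hS : ∀ n, S (n + 1) = step mix f g (γ n) (τ n) (S n)) (n : ℕ) :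
    m * (objective f g (avg (S (n + 1)).y) - objective f g u) / τ n ^ 2
        + L * c / 2 * frobSq ((S (n + 1)).z - constRows m u)
        + L * (stepErrors f g c (γ n) (τ n) (S n) (S (n + 1))).potential ≤
      (1 - τ 0) / τ 0 ^ 2 * (m * (objective f g (avg (S 0).y) - objective f g u))
        + L * c / 2 * frobSq ((S 0).z - constRows m u)
        + 2 * L * c * γ 0 ^ 2 * ρ * frobSq (dev (S 0).s) := by
  have hc₀ : 0 < c := by linarith
  have hmix' := hmix.mono hρ
  have hs : ∀ n, avg (S n).s = avg (gradRows f (S n).x) := fun n => by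
    induction n with
    | zero => rw [hS₀, initState]
    | succ n ih => rw [hS, hmix.avg_step_s ih]
  have hlyapunov := fun n => lyapunov_step_le hmix' hL hf hg hc (h.step_pos hL hc₀ n) (h.pos n)
    (h.le_half n) (h.mul_eq_one n) u (hs n) (hS n)
  have he := fun n => isNonneg_stepErrors (f := f) (g := g) (γ := γ n) (τ := τ n) hc₀.le (S n)
    (S (n + 1))
  induction n with
  | zero =>
    have hinit := hmix.total_add_potential_init_le (g := g) (γ := γ 0) hρ hc₀.le (h.pos 0)
      ((h.le_half 0).trans (by norm_num)) x₁ (hS₀ ▸ hS 0)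
    rw [← hS₀] at hinit
    linarith [hlyapunov 0, mul_le_mul_of_nonneg_left hinit hL.le]
  | succ n ih =>
    have hfollows := hmix'.follows_stepErrors (g := g) hL hf hc (h.mul_eq_one n) (h.sq_le n)
      (h.pos (n + 1)) ((h.le_half (n + 1)).trans (by norm_num)) (h.one_sub_div_le n) (hS n)
      (hS (n + 1))
    have hgap : 0 ≤ m * (objective f g (avg (S (n + 1)).y) - objective f g u) :=
      mul_nonneg (Nat.cast_nonneg m) (sub_nonneg.2 (hu _))
    have hweight := mul_le_mul_of_nonneg_right (h.one_sub_div_le n) hgap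
    rw [one_div_mul_eq_div] at hweight
    have herr := mul_le_mul_of_nonneg_left (hfollows.total_add_potential_le (he n) (he (n + 1)))
      hL.le
    linarith [hlyapunov (n + 1)]

lemma mul_gap_le (h : IsStepSchedule L c γ τ) (hL : 0 < L) (hc : 2 ≤ c)
    (hmix : IsMixing ρ mix) (hρ : ρ ≤ 1 / 16) (hf : ∀ i, IsConvexSmooth L (f i))
    (hg : ConvexOn ℝ Set.univ g) {u : Vec d} (hu : ∀ x, objective f g u ≤ objective f g x)
    (hS₀ : S 0 = initState f x₁) (hS : ∀ n, S (n + 1) = step mix f g (γ n) (τ n) (S n)) (n : ℕ) :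
    m * (objective f g (avg (S (n + 1)).y) - objective f g u) / τ n ^ 2 ≤
      (1 - τ 0) / τ 0 ^ 2 * (m * (objective f g (avg (S 0).y) - objective f g u))
        + L * c / 2 * frobSq ((S 0).z - constRows m u)
        + 2 * L * c * γ 0 ^ 2 * ρ * frobSq (dev (S 0).s) := by
  have hc₀ : 0 ≤ c := by linarith
  have hz : 0 ≤ L * c / 2 * frobSq ((S (n + 1)).z - constRows m u) :=
    mul_nonneg (by positivity) (frobSq_nonneg _)
  have hpotential := mul_nonneg hL.le (isNonneg_stepErrors (f := f) (g := g) (γ := γ n)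
    (τ := τ n) hc₀ (S n) (S (n + 1))).potential_nonneg
  linarith [h.weighted_gap_le hL hc hmix hρ hf hg hu hS₀ hS n]

end IsStepSchedule

lemma isStepSchedule_linear (hL : 0 < L) (hc : 0 < c)
    (hγ : ∀ t, γ t = ((t : ℝ) + 4) / (2 * L * c)) (hτ : ∀ t, τ t = 2 / ((t : ℝ) + 4)) :
    IsStepSchedule L c (fun n => γ (n + 1)) fun n => τ (n + 1) where
  pos n := by rw [hτ]; positivity
  le_half n := by
    rw [hτ, div_le_div_iff₀ (by positivity) two_pos]
    push_cast
    linarith [n.cast_nonneg (α := ℝ)]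
  mul_eq_one n := by rw [hγ, hτ]; field_simp
  one_sub_div_le n := by
    rw [hτ, hτ, div_pow, div_pow, one_div_div, div_le_div_iff₀ (by positivity) (by positivity)]
    push_cast
    field_simp
    nlinarith [n.cast_nonneg (α := ℝ)]
  sq_le n := by
    rw [hγ, hγ, div_pow, div_pow, ← mul_div_assoc]
    push_cast
    gcongr
    nlinarith [n.cast_nonneg (α := ℝ)]

lemma tracking_init_le (hL : 0 < L) (hc : 0 < c) (hρ : ρ * c ≤ 5 / 14) {r s : ℝ} (hr : 0 ≤ r)
    (hs : 0 ≤ s) : 2 * L * c * (5 / (2 * L * c)) ^ 2 * ρ * s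
      ≤ 25 * L / 2 * (r + 5 / (14 * L ^ 2 * c ^ 2) * s) := by
  calc 2 * L * c * (5 / (2 * L * c)) ^ 2 * ρ * s = 25 / (2 * L * c ^ 2) * (ρ * c) * s := by
        field_simp
        ring
    _ ≤ 25 / (2 * L * c ^ 2) * (5 / 14) * s := by gcongr
    _ = 25 * L / 2 * (5 / (14 * L ^ 2 * c ^ 2) * s) := by field_simp
    _ ≤ 25 * L / 2 * (r + 5 / (14 * L ^ 2 * c ^ 2) * s) := by
        gcongr
        exact le_add_of_nonneg_left hr

end Rate

end ODAPG

theorem theorem2_general {m d : ℕ} (hm : 0 < m)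
    (L : ℝ) (hL : 0 < L)
    (f : Fin m → ODAPG.Vec d → ℝ) (hf : ∀ i, ODAPG.IsConvexSmooth L (f i))
    (g : ODAPG.Vec d → ℝ) (hg : ConvexOn ℝ Set.univ g)
    {ρ : ℝ} {mix : ODAPG.Rows m d → ODAPG.Rows m d} (hmix : ODAPG.IsMixing ρ mix)
    (hρ : ρ ≤ 1 / 16)
    (c_f : ℝ) (hc : 2 ≤ c_f) (hρc : ρ * c_f ≤ 5 / 14)
    (γ τ : ℕ → ℝ) (hγ : ∀ t, γ t = ((t : ℝ) + 4) / (2 * L * c_f))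
    (hτ : ∀ t, τ t = 2 / ((t : ℝ) + 4))
    (x₁ xstar : ODAPG.Vec d) (hxstar : ∀ x, ODAPG.objective f g xstar ≤ ODAPG.objective f g x)
    (S : ℕ → ODAPG.State m d)
    (hS : S = ODAPG.run mix f g γ τ x₁)
    (T : ℕ) (hT : 2 ≤ T) :
    ODAPG.objective f g (ODAPG.avg (S T).y) - ODAPG.objective f g xstar ≤
      15 / ((T : ℝ) + 3) ^ 2 *
          (ODAPG.objective f g (ODAPG.avg (S 1).y) - ODAPG.objective f g xstar)
        + 2 * L * c_f / ((m : ℝ) * ((T : ℝ) + 3) ^ 2) *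
          ODAPG.frobSq ((S 1).z - ODAPG.constRows m xstar)
        + 50 * L / ((m : ℝ) * ((T : ℝ) + 3) ^ 2) *
          (ODAPG.frobSq (ODAPG.mulRows (ODAPG.centering m) (S 1).x)
            + 9 * τ 1 ^ 2 / 32 * ODAPG.frobSq (ODAPG.mulRows (ODAPG.centering m) (S 1).z)
            + 5 / (14 * L ^ 2 * c_f ^ 2) *
              ODAPG.frobSq (ODAPG.mulRows (ODAPG.centering m) (S 1).s)) := by
  have hmR : (0 : ℝ) < m := Nat.cast_pos.2 hm
  have hc₀ : 0 < c_f := by linarith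
  obtain ⟨n, rfl⟩ : ∃ n, T = n + 2 := ⟨T - 2, by omega⟩
  have hgap := (ODAPG.isStepSchedule_linear hL hc₀ hγ hτ).mul_gap_le (S := fun n => S (n + 1))
    (x₁ := x₁) hL hc hmix hρ hf hg hxstar (by rw [hS]; rfl) (fun n => by rw [hS]; rfl) n
  simp only [ODAPG.mulRows_centering, zero_add] at hgap ⊢
  have hr : 0 ≤ ODAPG.frobSq (ODAPG.dev (S 1).x)
      + 9 * τ 1 ^ 2 / 32 * ODAPG.frobSq (ODAPG.dev (S 1).z) :=
    add_nonneg (ODAPG.frobSq_nonneg _) (mul_nonneg (by positivity) (ODAPG.frobSq_nonneg _))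
  have htracking := ODAPG.tracking_init_le hL hc₀ hρc hr
    (ODAPG.frobSq_nonneg (ODAPG.dev (S 1).s))
  have hγ₁ : γ 1 = 5 / (2 * L * c_f) := by rw [hγ]; norm_num
  have hτ₁ : (1 - τ 1) / τ 1 ^ 2 = 15 / 4 := by rw [hτ]; norm_num
  have hτT : τ (n + 1) ^ 2 = 4 / (((n + 2 : ℕ) : ℝ) + 3) ^ 2 := by
    rw [hτ, div_pow]
    push_cast
    ring
  rw [hγ₁, hτ₁, hτT, div_le_iff₀ (by positivity)] at hgap
  refine le_of_mul_le_mul_left ?_ hmR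
  refine (hgap.trans (mul_le_mul_of_nonneg_right (add_le_add_right htracking _)
    (by positivity))).trans_eq ?_
  field_simp
  ring

theorem theorem2 {m d : ℕ} (hm : 2 ≤ m)
    (L : ℝ) (hL : 0 < L)
    (f : Fin m → ODAPG.Vec d → ℝ) (hf : ∀ i, ODAPG.IsConvexSmooth L (f i))
    (g : ODAPG.Vec d → ℝ) (hg : ConvexOn ℝ Set.univ g)
    (G : SimpleGraph (Fin m)) (W : Matrix (Fin m) (Fin m) ℝ) (hW : ODAPG.IsWeightMatrix G W)
    (lam : ℝ) (hlam : lam = ODAPG.lambda2 hm hW.posSemidef.isHermitian)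
    (c_f : ℝ) (hc : c_f = 200)
    (γ τ : ℕ → ℝ) (hγ : ∀ t, γ t = ((t : ℝ) + 4) / (2 * L * c_f))
    (hτ : ∀ t, τ t = 2 / ((t : ℝ) + 4))
    (K : ℕ) (hK : 15 / Real.sqrt (1 - lam) ≤ (K : ℝ))
    (x₁ xstar : ODAPG.Vec d) (hxstar : ∀ x, ODAPG.objective f g xstar ≤ ODAPG.objective f g x)
    (S : ℕ → ODAPG.State m d)
    (hS : S = ODAPG.run (fun x => ODAPG.fastMix W (ODAPG.mixParam lam) x K) f g γ τ x₁)
    (T : ℕ) (hT : 2 ≤ T) :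
    ODAPG.objective f g (ODAPG.avg (S T).y) - ODAPG.objective f g xstar ≤
      15 / ((T : ℝ) + 3) ^ 2 *
          (ODAPG.objective f g (ODAPG.avg (S 1).y) - ODAPG.objective f g xstar)
        + 2 * L * c_f / ((m : ℝ) * ((T : ℝ) + 3) ^ 2) *
          ODAPG.frobSq ((S 1).z - ODAPG.constRows m xstar)
        + 50 * L / ((m : ℝ) * ((T : ℝ) + 3) ^ 2) *
          (ODAPG.frobSq (ODAPG.mulRows (ODAPG.centering m) (S 1).x)
            + 9 * τ 1 ^ 2 / 32 * ODAPG.frobSq (ODAPG.mulRows (ODAPG.centering m) (S 1).z)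
            + 5 / (14 * L ^ 2 * c_f ^ 2) *
              ODAPG.frobSq (ODAPG.mulRows (ODAPG.centering m) (S 1).s)) := by
  have hmix := hW.isMixing_fastMix (d := d) hm hlam (N := 15) (by exact_mod_cast hK)
  exact theorem2_general (by omega) L hL f hf g hg hmix (by norm_num) c_f (by norm_num [hc])
    (by norm_num [hc]) γ τ hγ hτ x₁ xstar hxstar S hS T hT
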